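/- Let $S$ be a Polish space with metric $d$, let $\mathcal P(S)$ be the set of Borel probability measures on $S$, and let $C_b(S)\subset C(S)$ be the bounded continuous and the continuous functions $S\to\mathbb R$. Let $c:S\times S\to[0,\infty]$ be symmetric and put $$\mathrm{Lip}(c,S)=\{f\in C(S): f(x)-f(y)\le c(x,y)\ \text{for all } x,y\in S\},\qquad \Gamma=\mathrm{Lip}(c,S)\cap C_b(S).$$ Assume: 1. there is a nonempty $Q\subset C_b(S)$ with $c(x,y)=\sup_{u\in Q}(u(x)-u(y))$ for all $x,y\in S$; 2. $\Gamma$ is measure determining: for all $\mu\ne\nu$ in $\mathcal P(S)$ there is $f\in\Gamma$ with $\int f\,d\mu\ne\int f\,d\nu$; 3. there is $a:S\to[0,\infty)$ with $c(x,y)\le a(x)+a(y)$ for all $x,y\in S$; 4. there are compact sets $K_1\subset K_2\subset\cdots$ with $S=\bigcup_m K_m$ and, for each $m$, a function $\theta_m:[0,\infty)\to[0,\infty)$ with $\lim_{t\to0}\theta_m(t)=0$ and a $\delta_m>0$ such that $c(x,y)\le\theta_m(d(x,y))$ for all $x,y\in K_m$ with $d(x,y)\le\delta_m$. For $\mu,\nu,\gamma\in\mathcal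 P(S)$ let $R(\gamma\|\nu)$ be the relative entropy ($\int\log\frac{d\gamma}{d\nu}\,d\gamma$ if $\gamma\ll\nu$, and $\infty$ otherwise), and let $$W_c(\mu,\gamma)=\sup_{g\in\Gamma}\int_S g\,d(\mu-\gamma),\qquad G(\mu\|\nu)=\sup_{g\in\Gamma}\Big\{\int_S g\,d\mu-\log\int_S e^g\,d\nu\Big\}.$$ Fix $\mu,\nu\in\mathcal P(S)$ with $\int a\,d\mu<\infty$ and $\int a\,d\nu<\infty$. Suppose that $g_1\in\mathrm{Lip}(c,S)$ and $\gamma_1\in\mathcal P(S)$ satisfy $$\text{(i)}\quad \gamma_1\ll\nu,\quad \frac{d\gamma_1}{d\nu}(x)=\frac{e^{g_1(x)}}{\int_S e^{g_1}\,d\nu}\quad \nu\text{-a.s.},\qquad\qquad \text{(ii)}\quad W_c(\mu,\gamma_1)=\int_S g_1\,d(\mu-\gamma_1).$$ Then $g_1$ and $\gamma_1$ are optimizers in the two variational representations of $G(\mu\|\nu)$: $g_1$ is $\mu$-integrable, $e^{g_1}$ is $\nu$-integrable, and $$G(\mu\|\nu)=\int_S g_1\,d\mu-\log\int_S e^{g_1}\,d\nu,$$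 $$G(\mu\|\nu)=W_c(\mu,\gamma_1)+R(\gamma_1\|\nu)=\min_{\gamma\in\mathcal P(S)}\big\{W_c(\mu,\gamma)+R(\gamma\|\nu)\big\}.$$ -/

import Mathlib

open MeasureTheory Filter Topology
open scoped ENNReal NNReal BoundedContinuousFunction

noncomputable section

namespace GammaDiv

section Cost

variable {S : Type*} [TopologicalSpace S]

/-- `Lip(c,S)`: the continuous `f : S → ℝ` with `f x - f y ≤ c x y` for all `x, y`. -/
def lip (c : S → S → ℝ≥0∞) : Set C(S, ℝ) :=
  {f | ∀ x y, ((f x - f y : ℝ) : EReal) ≤ (c x y : EReal)}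

/-- `Lip(c,S;C_b(S))`: the bounded continuous `f : S → ℝ` with `f x - f y ≤ c x y`. -/
def lipBdd (c : S → S → ℝ≥0∞) : Set (S →ᵇ ℝ) :=
  {f | ∀ x y, ((f x - f y : ℝ) : EReal) ≤ (c x y : EReal)}

/-- There is a nonempty `Q ⊆ C_b(S)` with `c x y = sup_{u ∈ Q} (u x - u y)` for all `x, y`. -/
def HasSupRepresentation (c : S → S → ℝ≥0∞) : Prop :=
  ∃ Q : Set (S →ᵇ ℝ), Q.Nonempty ∧
    ∀ x y, (c x y : EReal) = ⨆ u ∈ Q, ((u x - u y : ℝ) : EReal)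

end Cost

/-- `S` is the union of an increasing sequence of compact sets `K m`, and on each `K m` the cost
`c x y` is bounded, for `dist x y ≤ δ`, by `θ (dist x y)` with `θ t → 0` as `t → 0`. -/
def IsLocallyControlled {S : Type*} [MetricSpace S] (c : S → S → ℝ≥0∞) : Prop :=
  ∃ K : ℕ → Set S, (∀ m, IsCompact (K m)) ∧ (∀ m, K m ⊆ K (m + 1)) ∧ (⋃ m, K m) = Set.univ ∧
    ∀ m, ∃ θ : ℝ≥0 → ℝ≥0, Tendsto θ (𝓝[≠] 0) (𝓝 0) ∧
      ∃ δ : ℝ, 0 < δ ∧ ∀ x ∈ K m, ∀ y ∈ K m, dist x y ≤ δ →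
        c x y ≤ (θ (nndist x y) : ℝ≥0∞)

section Divergence

variable {S : Type*} [TopologicalSpace S] [MeasurableSpace S] [BorelSpace S]

/-- A set of bounded continuous functions is measure determining: it separates the points of
`P(S)`. -/
def IsMeasureDetermining (Γ : Set (S →ᵇ ℝ)) : Prop :=
  ∀ μ ν : ProbabilityMeasure S, μ ≠ ν →
    ∃ f ∈ Γ, ∫ x, f x ∂(μ : Measure S) ≠ ∫ x, f x ∂(ν : Measure S)

/-- `L¹(a)`: the probability measures with respect to which `a ≥ 0` has finite integral. -/
def L1 (a : S → ℝ≥0) : Set (ProbabilityMeasure S) :=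
  {θ | Integrable (fun x => (a x : ℝ)) (θ : Measure S)}

/-- The `Γ`-divergence
`G_Γ(μ‖ν) = sup_{g ∈ Γ} (∫ g dμ - log ∫ e^g dν)`. -/
def divergence (Γ : Set (S →ᵇ ℝ)) (μ ν : ProbabilityMeasure S) : EReal :=
  ⨆ g ∈ Γ, ((∫ x, g x ∂(μ : Measure S)
    - Real.log (∫ x, Real.exp (g x) ∂(ν : Measure S)) : ℝ) : EReal)

/-- The transport cost
`W_c(μ,γ) = sup_{g ∈ Lip(c,S;C_b(S))} ∫ g d(μ - γ)`. -/
def transportCost (c : S → S → ℝ≥0∞) (μ γ : ProbabilityMeasure S) : EReal :=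
  ⨆ g ∈ lipBdd c, ((∫ x, g x ∂(μ : Measure S) - ∫ x, g x ∂(γ : Measure S) : ℝ) : EReal)

/-- The relative entropy `R(γ‖ν)`, as an extended real number. -/
def relEntropy (γ ν : ProbabilityMeasure S) : EReal :=
  (InformationTheory.klDiv (γ : Measure S) (ν : Measure S) : EReal)

/-- `γ ≪ ν`, and `dγ/dν = e^g / ∫ e^g dν` holds `ν`-almost surely. -/
def HasGibbsDensity (g : C(S, ℝ)) (γ ν : ProbabilityMeasure S) : Prop :=
  (γ : Measure S) ≪ (ν : Measure S) ∧
    (γ : Measure S).rnDeriv (ν : Measure S) =ᵐ[(ν : Measure S)] fun x =>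
      ENNReal.ofReal (Real.exp (g x)) / ∫⁻ y, ENNReal.ofReal (Real.exp (g y)) ∂(ν : Measure S)

/-- `γ` is an optimizer of
`G(μ‖ν) = inf_{γ ∈ P(S)} (W_c(μ,γ) + R(γ‖ν))`, with `Γ = Lip(c,S;C_b(S))`:
its objective value is the infimum, and this infimum is the `Γ`-divergence. -/
def IsMeasureOptimizer (c : S → S → ℝ≥0∞) (μ ν γ : ProbabilityMeasure S) : Prop :=
  (∀ γ' : ProbabilityMeasure S,
    transportCost c μ γ + relEntropy γ ν ≤ transportCost c μ γ' + relEntropy γ' ν) ∧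
  divergence (lipBdd c) μ ν = transportCost c μ γ + relEntropy γ ν

/-- `g ∈ Lip(c,S)`, possibly unbounded, is an optimizer of
`G(μ‖ν) = sup_{g ∈ Γ} (∫ g dμ - log ∫ e^g dν)`, with `Γ = Lip(c,S;C_b(S))`:
both integrals are finite and the objective value at `g` is the supremum. -/
def IsFunctionOptimizer (c : S → S → ℝ≥0∞) (μ ν : ProbabilityMeasure S) (g : C(S, ℝ)) : Prop :=
  g ∈ lip c ∧
  Integrable (fun x => g x) (μ : Measure S) ∧
  Integrable (fun x => Real.exp (g x)) (ν : Measure S) ∧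
  divergence (lipBdd c) μ ν =
    ((∫ x, g x ∂(μ : Measure S) - Real.log (∫ x, Real.exp (g x) ∂(ν : Measure S)) : ℝ) : EReal)

end Divergence

end GammaDiv

end

/-!
The proof is a sandwich. Write `Γ` for `lipBdd c`, `G` for the divergence of `Γ`, `W_c` for the
transport cost and `R` for the relative entropy. For every probability measure `γ`, each `g ∈ Γ`
satisfies
`∫ g dμ - log ∫ e^g dν = ∫ g d(μ - γ) + (∫ g dγ - log ∫ e^g dν) ≤ W_c(μ,γ) + R(γ‖ν)`, the second
summand being controlled by the easy half of the Donsker–Varadhan formula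
(`integral_sub_log_integral_exp_le_klDiv`). Hence `G(μ‖ν) ≤ W_c(μ,γ) + R(γ‖ν)` for all `γ`
(`divergence_le`). At `γ₁`, which is the exponential tilting of `ν` by `g₁`, the entropy is
`∫ g₁ dγ₁ - log ∫ e^{g₁} dν` (`klDiv_tilted_left`), and since `g₁` attains `W_c(μ,γ₁)`, the upper
bound becomes `∫ g₁ dμ - log ∫ e^{g₁} dν`. Conversely, this number is at most `G(μ‖ν)`
(`le_divergence_of_mem_lip`): the truncations of `g₁` at levels `-n` and `n` belong to `Γ`, and
both of their integrals converge by dominated convergence. So all inequalities are equalities.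

The integrability of `g₁` has three sources. With respect to `μ` it follows from
`c x y ≤ a x + a y`. The function `e^{g₁}` is `ν`-integrable because otherwise the density of `γ₁`
would vanish. With respect to `γ₁` it is a consequence of the finiteness of `W_c(μ,γ₁)`
(`integrable_of_transportCost_le`): the functions `-min(|g₁|, n)` are admissible in its definition.
-/

namespace GammaDiv

/-! ### Truncations of cost-Lipschitz functions -/

section Truncation

variable {S : Type*} [TopologicalSpace S] {c : S → S → ℝ≥0∞}

/-- Composing with a bounded `1`-Lipschitz function of the line, for instance a truncation, maps
`Lip(c,S)` into `Lip(c,S;C_b(S))`. The symmetry of `c` is needed because `φ` may reverse order. -/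
lemma exists_mem_lipBdd_comp (hsymm : ∀ x y, c x y = c y x) {g : C(S, ℝ)} (hg : g ∈ lip c)
    {φ : ℝ → ℝ} (hφ : LipschitzWith 1 φ) {C : ℝ} (hC : ∀ t, |φ t| ≤ C) :
    ∃ h ∈ lipBdd c, ∀ x, h x = φ (g x) := by
  refine ⟨BoundedContinuousFunction.ofNormedAddCommGroup (fun x => φ (g x))
    (hφ.continuous.comp g.continuous) C fun x => hC _, fun x y => ?_, fun x => rfl⟩
  have habs : φ (g x) - φ (g y) ≤ |g x - g y| := by
    have h := hφ.dist_le_mul (g x) (g y)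
    rw [Real.dist_eq, Real.dist_eq, NNReal.coe_one, one_mul] at h
    exact (le_abs_self _).trans h
  refine (EReal.coe_le_coe_iff.2 habs).trans ?_
  rcases abs_cases (g x - g y) with ⟨h, -⟩ | ⟨h, -⟩
  · rw [h]
    exact hg x y
  · rw [h, neg_sub, hsymm]
    exact hg y x

/-- `t ↦ max (-n) (min t n)`, the truncation of the line at levels `-n` and `n`. -/
def clamp (n : ℕ) (t : ℝ) : ℝ := max (-n) (min t n)

lemma lipschitzWith_clamp (n : ℕ) : LipschitzWith 1 (clamp n) :=
  (LipschitzWith.id.min_const _).const_max _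

lemma abs_clamp_le_natCast (n : ℕ) (t : ℝ) : |clamp n t| ≤ n :=
  abs_le.2 ⟨le_max_left _ _, max_le (by simp) (min_le_right _ _)⟩

lemma abs_clamp_le_abs (n : ℕ) (t : ℝ) : |clamp n t| ≤ |t| := by
  have hn : (0 : ℝ) ≤ n := n.cast_nonneg
  refine abs_le.2 ⟨?_, max_le ?_ ((min_le_left _ _).trans (le_abs_self _))⟩
  · rcases le_total t n with h | h
    · exact (neg_abs_le t).trans ((le_min le_rfl h).trans (le_max_right _ _))
    · rw [clamp, min_eq_right h]
      exact (neg_nonpos.2 (abs_nonneg t)).trans (hn.trans (le_max_right _ _))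
  · exact (neg_nonpos.2 hn).trans (abs_nonneg t)

lemma exp_clamp_le (n : ℕ) (t : ℝ) : Real.exp (clamp n t) ≤ Real.exp t + 1 := by
  rcases le_total t 0 with h | h
  · have : clamp n t ≤ 0 := max_le (by simp) ((min_le_left _ _).trans h)
    linarith [Real.exp_le_one_iff.2 this, Real.exp_pos t]
  · have : clamp n t ≤ t := max_le (by linarith [n.cast_nonneg (α := ℝ)]) (min_le_left _ _)
    linarith [Real.exp_le_exp.2 this]

lemma tendsto_clamp (t : ℝ) : Tendsto (fun n : ℕ => clamp n t) atTop (𝓝 t) := by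
  refine tendsto_const_nhds.congr' ?_
  filter_upwards [eventually_ge_atTop ⌈|t|⌉₊] with n hn
  have h := abs_le.1 (Nat.ceil_le.1 hn)
  rw [clamp, min_eq_left h.2, max_eq_right h.1]

end Truncation

/-! ### Relative entropy -/

section Entropy

open InformationTheory

variable {α : Type*} {mα : MeasurableSpace α}

/-- The easy half of the Donsker–Varadhan variational formula. It is Gibbs' inequality for `γ` and
the tilted measure `e^f ν / ∫ e^f dν`. -/
lemma integral_sub_log_integral_exp_le_klDiv (γ ν : Measure α) [IsProbabilityMeasure γ]
    [IsProbabilityMeasure ν] {f : α → ℝ} (hfγ : Integrable f γ)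
    (hfν : Integrable (fun x => Real.exp (f x)) ν) :
    ((∫ x, f x ∂γ - Real.log (∫ x, Real.exp (f x) ∂ν) : ℝ) : EReal) ≤ (klDiv γ ν : EReal) := by
  by_cases htop : klDiv γ ν = ∞
  · simp [htop]
  obtain ⟨hac, hint⟩ := klDiv_ne_top_iff.1 htop
  have := isProbabilityMeasure_tilted hfν
  have hnonneg := integral_llr_add_sub_measure_univ_nonneg
    (hac.trans (absolutelyContinuous_tilted hfν)) (integrable_llr_tilted_right hac hfγ hint hfν)
  rw [integral_llr_tilted_right hac hfγ hfν hint] at hnonneg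
  simp only [probReal_univ] at hnonneg
  have hkl := toReal_klDiv_of_measure_eq hac (by simp)
  rw [← EReal.coe_ennreal_toReal htop, hkl, EReal.coe_le_coe_iff]
  linarith

lemma klDiv_tilted_left (ν : Measure α) [IsProbabilityMeasure ν] {f : α → ℝ}
    (hfν : Integrable (fun x => Real.exp (f x)) ν) (hf : Integrable f (ν.tilted f)) :
    (klDiv (ν.tilted f) ν : EReal) =
      ((∫ x, f x ∂(ν.tilted f) - Real.log (∫ x, Real.exp (f x) ∂ν) : ℝ) : EReal) := by
  have := isProbabilityMeasure_tilted hfν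
  have hac := tilted_absolutelyContinuous ν f
  have hllr : llr (ν.tilted f) ν =ᵐ[ν.tilted f]
      fun x => f x - Real.log (∫ y, Real.exp (f y) ∂ν) :=
    hac.ae_le (log_rnDeriv_tilted_left_self hfν)
  have hint : Integrable (llr (ν.tilted f) ν) (ν.tilted f) :=
    (integrable_congr hllr).2 (hf.sub (integrable_const _))
  have hkl := toReal_klDiv_of_measure_eq hac (by simp)
  rw [integral_congr_ae hllr, integral_sub hf (integrable_const _), integral_const, probReal_univ,
    one_smul] at hkl
  rw [← hkl, EReal.coe_ennreal_toReal (klDiv_ne_top hac hint)]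

/-- A measure with Gibbs density `e^g / ∫ e^g dν` is the exponential tilting of `ν` by `g`. The
normalizing constant is finite because an infinite one would make the density vanish. -/
lemma HasGibbsDensity.integrable_exp_and_eq_tilted {S : Type*} [TopologicalSpace S]
    [MeasurableSpace S] [BorelSpace S] {g : C(S, ℝ)} {γ ν : ProbabilityMeasure S}
    (h : HasGibbsDensity g γ ν) :
    Integrable (fun x => Real.exp (g x)) (ν : Measure S) ∧
      (γ : Measure S) = (ν : Measure S).tilted g := by
  obtain ⟨hac, hd⟩ := h
  have hγ := Measure.withDensity_rnDeriv_eq _ _ hac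
  rw [withDensity_congr_ae hd] at hγ
  have hmeas : AEStronglyMeasurable (fun x => Real.exp (g x)) (ν : Measure S) :=
    (Real.measurable_exp.comp g.continuous.measurable).aestronglyMeasurable
  have hfin : ∫⁻ y, ENNReal.ofReal (Real.exp (g y)) ∂(ν : Measure S) ≠ ∞ := by
    intro htop
    refine IsProbabilityMeasure.ne_zero (γ : Measure S) ?_
    rw [← hγ]
    simp [htop]
  have hexp : Integrable (fun x => Real.exp (g x)) (ν : Measure S) :=
    (lintegral_ofReal_ne_top_iff_integrable hmeas (ae_of_all _ fun x => (Real.exp_pos _).le)).1 hfin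
  refine ⟨hexp, ?_⟩
  rw [← hγ, Measure.tilted]
  congr 1
  ext x
  rw [ENNReal.ofReal_div_of_pos (integral_exp_pos hexp),
    ofReal_integral_eq_lintegral_ofReal hexp (ae_of_all _ fun x => (Real.exp_pos _).le)]

end Entropy

/-! ### Bounds for the divergence and the transport cost -/

section Duality

variable {S : Type*} [TopologicalSpace S] [MeasurableSpace S] [BorelSpace S]
  {c : S → S → ℝ≥0∞} {μ ν γ : ProbabilityMeasure S}

lemma integrable_boundedContinuousFunction (μ : ProbabilityMeasure S) (g : S →ᵇ ℝ) :
    Integrable (fun x => g x) (μ : Measure S) :=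
  .of_bound g.continuous.measurable.aestronglyMeasurable ‖g‖ (ae_of_all _ g.norm_coe_le_norm)

lemma integrable_exp_boundedContinuousFunction (μ : ProbabilityMeasure S) (g : S →ᵇ ℝ) :
    Integrable (fun x => Real.exp (g x)) (μ : Measure S) :=
  .of_bound (Real.measurable_exp.comp g.continuous.measurable).aestronglyMeasurable
    (Real.exp ‖g‖) (ae_of_all _ fun x => by
      rw [Real.norm_eq_abs, Real.abs_exp]
      exact Real.exp_le_exp.2 ((le_abs_self _).trans (g.norm_coe_le_norm x)))

/-- Weak duality between the two variational representations. -/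
lemma divergence_le (c : S → S → ℝ≥0∞) (μ ν γ : ProbabilityMeasure S) :
    divergence (lipBdd c) μ ν ≤ transportCost c μ γ + relEntropy γ ν := by
  refine iSup₂_le fun g hg => ?_
  have hW : ((∫ x, g x ∂(μ : Measure S) - ∫ x, g x ∂(γ : Measure S) : ℝ) : EReal)
      ≤ transportCost c μ γ :=
    le_iSup₂ (f := fun (g : S →ᵇ ℝ) (_ : g ∈ lipBdd c) =>
      ((∫ x, g x ∂(μ : Measure S) - ∫ x, g x ∂(γ : Measure S) : ℝ) : EReal)) g hg
  have hR := integral_sub_log_integral_exp_le_klDiv (γ : Measure S) (ν : Measure S)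
    (integrable_boundedContinuousFunction γ g) (integrable_exp_boundedContinuousFunction ν g)
  refine le_trans (le_of_eq ?_) (add_le_add hW hR)
  rw [← EReal.coe_add, sub_add_sub_cancel]

lemma integrable_of_mem_lip {g : C(S, ℝ)} (hg : g ∈ lip c)
    {a : S → ℝ≥0} (ha : ∀ x y, c x y ≤ (a x : ℝ≥0∞) + (a y : ℝ≥0∞)) (hμ : μ ∈ L1 a) :
    Integrable (fun x => g x) (μ : Measure S) := by
  obtain ⟨y⟩ := μ.nonempty
  have hle : ∀ x z, g x - g z ≤ a x + a z := fun x z => by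
    have h : ((g x - g z : ℝ) : EReal) ≤ (((a x + a z : ℝ≥0) : ℝ≥0∞) : EReal) :=
      (hg x z).trans (EReal.coe_ennreal_le_coe_ennreal_iff.2 (by simpa using ha x z))
    rwa [EReal.coe_nnreal_eq_coe_real, EReal.coe_le_coe_iff] at h
  refine Integrable.mono' (g := fun x => (a x : ℝ) + (a y + |g y|))
    (Integrable.add hμ (integrable_const _))
    g.continuous.measurable.aestronglyMeasurable (ae_of_all _ fun x => ?_)
  rw [Real.norm_eq_abs]
  exact abs_le.2 ⟨by linarith [hle y x, neg_abs_le (g y)], by linarith [hle x y, le_abs_self (g y)]⟩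

/-- Unbounded cost-Lipschitz functions do not exceed the divergence, by truncation. -/
lemma le_divergence_of_mem_lip (hsymm : ∀ x y, c x y = c y x) {g : C(S, ℝ)} (hg : g ∈ lip c)
    (hgμ : Integrable (fun x => g x) (μ : Measure S))
    (hgν : Integrable (fun x => Real.exp (g x)) (ν : Measure S)) :
    ((∫ x, g x ∂(μ : Measure S) - Real.log (∫ x, Real.exp (g x) ∂(ν : Measure S)) : ℝ) : EReal)
      ≤ divergence (lipBdd c) μ ν := by
  have hmeas (n : ℕ) : Measurable fun x => clamp n (g x) :=
    ((lipschitzWith_clamp n).continuous.comp g.continuous).measurable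
  have h₁ : Tendsto (fun n : ℕ => ∫ x, clamp n (g x) ∂(μ : Measure S)) atTop
      (𝓝 (∫ x, g x ∂(μ : Measure S))) :=
    tendsto_integral_of_dominated_convergence _ (fun n => (hmeas n).aestronglyMeasurable) hgμ.abs
      (fun n => ae_of_all _ fun x => abs_clamp_le_abs n _)
      (ae_of_all _ fun x => tendsto_clamp _)
  have h₂ : Tendsto (fun n : ℕ => ∫ x, Real.exp (clamp n (g x)) ∂(ν : Measure S)) atTop
      (𝓝 (∫ x, Real.exp (g x) ∂(ν : Measure S))) :=
    tendsto_integral_of_dominated_convergence _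
      (fun n => (Real.measurable_exp.comp (hmeas n)).aestronglyMeasurable)
      (hgν.add (integrable_const 1))
      (fun n => ae_of_all _ fun x => by
        rw [Real.norm_eq_abs, Real.abs_exp]
        exact exp_clamp_le n _)
      (ae_of_all _ fun x => (Real.continuous_exp.tendsto _).comp (tendsto_clamp _))
  refine le_of_tendsto ((continuous_coe_real_ereal.tendsto _).comp
    (h₁.sub (h₂.log (integral_exp_pos hgν).ne'))) (Eventually.of_forall fun n => ?_)
  obtain ⟨h, hh, heq⟩ :=
    exists_mem_lipBdd_comp hsymm hg (lipschitzWith_clamp n) (abs_clamp_le_natCast n)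
  simp only [Function.comp_apply, ← heq]
  exact le_iSup₂ (f := fun (g : S →ᵇ ℝ) (_ : g ∈ lipBdd c) =>
    ((∫ x, g x ∂(μ : Measure S)
      - Real.log (∫ x, Real.exp (g x) ∂(ν : Measure S)) : ℝ) : EReal)) h hh

/-- If the transport cost between `μ` and `γ` is finite, integrability of a cost-Lipschitz function
passes from `μ` to `γ`. -/
lemma integrable_of_transportCost_le (hsymm : ∀ x y, c x y = c y x) {g : C(S, ℝ)} (hg : g ∈ lip c)
    (hgμ : Integrable (fun x => g x) (μ : Measure S)) {w : ℝ}
    (hw : transportCost c μ γ ≤ (w : EReal)) :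
    Integrable (fun x => g x) (γ : Measure S) := by
  -- The uniform bound on `∫ min(|g|, n) dγ` is the cost of the admissible function `-min(|g|, n)`.
  have hbound (n : ℕ) : ∫⁻ x, ‖clamp n (g x)‖ₑ ∂(γ : Measure S)
      ≤ ENNReal.ofReal (w + ∫ x, |g x| ∂(μ : Measure S)) := by
    have hφ : LipschitzWith 1 fun t => -|clamp n t| := by
      have h := ((lipschitzWith_one_norm (E := ℝ)).comp (lipschitzWith_clamp n)).neg
      rwa [one_mul] at h
    obtain ⟨h, hh, heq⟩ := exists_mem_lipBdd_comp hsymm hg hφ (C := n)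
      (fun t => by rw [abs_neg, abs_abs]; exact abs_clamp_le_natCast n t)
    have hle : ∫ x, h x ∂(μ : Measure S) - ∫ x, h x ∂(γ : Measure S) ≤ w :=
      EReal.coe_le_coe_iff.1 ((le_iSup₂ (f := fun (g : S →ᵇ ℝ) (_ : g ∈ lipBdd c) =>
        ((∫ x, g x ∂(μ : Measure S) - ∫ x, g x ∂(γ : Measure S) : ℝ) : EReal)) h hh).trans hw)
    have hγ : Integrable (fun x => |clamp n (g x)|) (γ : Measure S) := by
      simpa [heq] using (integrable_boundedContinuousFunction γ h).neg
    have hμ : Integrable (fun x => |clamp n (g x)|) (μ : Measure S) := by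
      simpa [heq] using (integrable_boundedContinuousFunction μ h).neg
    simp only [Real.enorm_eq_ofReal_abs]
    rw [← ofReal_integral_eq_lintegral_ofReal hγ (ae_of_all _ fun x => abs_nonneg _)]
    refine ENNReal.ofReal_le_ofReal ?_
    have hmono := integral_mono hμ hgμ.abs fun x => abs_clamp_le_abs n (g x)
    simp only [heq, integral_neg] at hle
    linarith
  have hfatou : ∫⁻ x, ‖g x‖ₑ ∂(γ : Measure S)
      ≤ liminf (fun n : ℕ => ∫⁻ x, ‖clamp n (g x)‖ₑ ∂(γ : Measure S)) atTop := by
    refine (lintegral_congr fun x => ?_).trans_le (lintegral_liminf_le fun n =>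
      ((lipschitzWith_clamp n).continuous.comp g.continuous).measurable.enorm)
    exact (tendsto_clamp (g x)).enorm.liminf_eq.symm
  refine ⟨g.continuous.measurable.aestronglyMeasurable, hfatou.trans_lt ?_⟩
  refine (liminf_le_of_frequently_le' (Frequently.of_forall hbound)).trans_lt ENNReal.ofReal_lt_top

end Duality

end GammaDiv

theorem mainTheorem5 {S : Type*} [MetricSpace S] [PolishSpace S] [MeasurableSpace S] [BorelSpace S]
    (c : S → S → ℝ≥0∞) (hsymm : ∀ x y, c x y = c y x)
    (hrep : GammaDiv.HasSupRepresentation c)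
    (hdet : GammaDiv.IsMeasureDetermining (GammaDiv.lipBdd c))
    (a : S → ℝ≥0) (ha : ∀ x y, c x y ≤ (a x : ℝ≥0∞) + (a y : ℝ≥0∞))
    (hcont : GammaDiv.IsLocallyControlled c)
    (μ ν : ProbabilityMeasure S) (hμ : μ ∈ GammaDiv.L1 a) (hν : ν ∈ GammaDiv.L1 a)
    (g₁ : C(S, ℝ)) (hg₁ : g₁ ∈ GammaDiv.lip c) (γ₁ : ProbabilityMeasure S)
    (hdens : GammaDiv.HasGibbsDensity g₁ γ₁ ν)
    (hcost : GammaDiv.transportCost c μ γ₁ =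
      ((∫ x, g₁ x ∂(μ : Measure S) - ∫ x, g₁ x ∂(γ₁ : Measure S) : ℝ) : EReal)) :
    GammaDiv.IsFunctionOptimizer c μ ν g₁ ∧ GammaDiv.IsMeasureOptimizer c μ ν γ₁ := by
  obtain ⟨hexp, htilt⟩ := hdens.integrable_exp_and_eq_tilted
  have hgμ := GammaDiv.integrable_of_mem_lip hg₁ ha hμ
  -- `hcost` only enters through finiteness here: `∫ g₁ dγ₁` could still be a junk value.
  have hgγ := GammaDiv.integrable_of_transportCost_le hsymm hg₁ hgμ hcost.le
  have hR : GammaDiv.relEntropy γ₁ ν = ((∫ x, g₁ x ∂(γ₁ : Measure S)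
      - Real.log (∫ x, Real.exp (g₁ x) ∂(ν : Measure S)) : ℝ) : EReal) := by
    rw [htilt] at hgγ
    rw [GammaDiv.relEntropy, htilt]
    exact GammaDiv.klDiv_tilted_left _ hexp hgγ
  have hvalue : GammaDiv.transportCost c μ γ₁ + GammaDiv.relEntropy γ₁ ν =
      ((∫ x, g₁ x ∂(μ : Measure S)
        - Real.log (∫ x, Real.exp (g₁ x) ∂(ν : Measure S)) : ℝ) : EReal) := by
    rw [hcost, hR, ← EReal.coe_add, sub_add_sub_cancel]
  have hge := GammaDiv.le_divergence_of_mem_lip hsymm hg₁ hgμ hexp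
  have heq := le_antisymm (GammaDiv.divergence_le c μ ν γ₁) (hvalue.trans_le hge)
  exact ⟨⟨hg₁, hgμ, hexp, heq.trans hvalue⟩,
    fun γ' => heq.symm.trans_le (GammaDiv.divergence_le c μ ν γ'), heq⟩
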